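/- Work in the 2-category $\mathbf{2Hilb}$ in matrix form: objects are $\mathbf{Hilb}^n$ ($n\in\mathbb N$), 1-cells are matrices of finite-dimensional complex Hilbert spaces (composed by matrix multiplication with $\oplus,\otimes$), 2-cells are matrices of linear maps, and $\dagger$ takes entrywise adjoints; a 2-cell $\eta$ is (vertically) unitary if $\eta^\dagger$ is its inverse under vertical composition. 1-cells are composed from left to right. Let $W:\mathbf{Hilb}\to\mathbf{Hilb}^n$ and $W':\mathbf{Hilb}^n\to\mathbf{Hilb}$ be the witnesses (all entries $\mathbb C$), with the 2-cells $\mathrm{create}:\mathrm{id}\Rightarrow W W'$, $1\mapsto\sum_k 1_k\otimes 1_k$, and $\mathrm{copy}:\mathrm{id}\Rightarrow W'W$, $1\mapsto 1\otimes 1$ on the diagonal, $\mathrm{delete}=\mathrm{create}^\dagger$, $\mathrm{compare}=\mathrm{copy}^\dagger$. These give adjunctions $W\dashv W'$ (unit create, counit compare) and $W'\dashv W$ (unit copy, counit delete). A nondegenerate measurement of a system $H$ (a finite-dimensional Hilbert space viewed as a 1-cell $\mathbf{Hilb}\to\mathbf{Hilb}$) with $n$ outcomes is a unitary 2-cell $H\Rightarrow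 WW'$; equivalently it is an ordered orthonormal basis of $H$, consisting of the states that it sends to the $n$ outcomes. A 2-cell $f:WW'\Rightarrow WW'$ is horizontally unitary if the 2-cell $W'W\Rightarrow W'W$ obtained from it by bending the upper left wire down with compare and the lower right wire up with copy is unitary. Theorem. Let $R,G:H\Rightarrow WW'$ be nondegenerate measurements (red and green) with $n$ outcomes of the same system $H$, with orthonormal bases $(a_i)$ and $(b_j)$. The preparation–measurement composite $G\cdot R^\dagger: WW'\Rightarrow WW'$ is vertically unitary, and the following are equivalent: 1. the two observables are complementary: $|\langle a_i|b_j\rangle|^2=\frac1{\dim H}$ for all $i,j$; 2. the two observables are physically complementary: there is a unitary 2-cell $\phi:W'W\Rightarrow W'W$ (a controlled phase) such that measuring in red, copying the outcome, encoding the second copy using $R^\dagger$ and measuring in green equals $\frac1{\sqrt n}$ times measuring in red, creating uniform classical data next to it, and applying $\phi$ to the two adjacent regions of classical data; 3. there is a scalar $c\in\mathbb C$, $c\neq0$, such that $c\,(G\cdot R^\dagger)$ is horizontally unitary. -/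

import Mathlib

open CategoryTheory Bicategory
open scoped TensorProduct

noncomputable section

namespace TwoHilbert

/-- A finite-dimensional complex Hilbert space. -/
structure FdHilb where
  carrier : Type
  [normed : NormedAddCommGroup carrier]
  [inner : InnerProductSpace ℂ carrier]
  [finite : FiniteDimensional ℂ carrier]

instance : CoeSort FdHilb Type := ⟨FdHilb.carrier⟩

attribute [instance] FdHilb.normed FdHilb.inner FdHilb.finite

section DirectSum

variable {ι : Type} [DecidableEq ι]

/-- The orthogonal direct sum of a finite family of Hilbert spaces. -/
abbrev DSum {ι : Type} (E : ι → FdHilb) : Type := PiLp 2 (fun i => (E i : Type))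

/-- The inclusion of a summand. -/
def incl (E : ι → FdHilb) (i : ι) : E i →ₗ[ℂ] DSum E :=
  (WithLp.linearEquiv 2 ℂ (∀ i, E i)).symm.toLinearMap ∘ₗ LinearMap.single ℂ (fun i => (E i : Type)) i

/-- The projection onto a summand. -/
def proj (E : ι → FdHilb) (i : ι) : DSum E →ₗ[ℂ] E i :=
  LinearMap.proj i ∘ₗ (WithLp.linearEquiv 2 ℂ (∀ i, E i)).toLinearMap

theorem proj_incl_same (E : ι → FdHilb) (i : ι) (x : E i) : proj E i (incl E i x) = x := by
  simp [proj, incl]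

theorem proj_incl_ne (E : ι → FdHilb) {i j : ι} (h : j ≠ i) (x : E i) :
    proj E j (incl E i x) = 0 := by
  simp [proj, incl, h]

theorem dsum_ext [Fintype ι] {E : ι → FdHilb} {V : Type*} [AddCommMonoid V] [Module ℂ V]
    {f g : DSum E →ₗ[ℂ] V} (h : ∀ i x, f (incl E i x) = g (incl E i x)) : f = g := by
  have : f ∘ₗ (WithLp.linearEquiv 2 ℂ (∀ i, E i)).symm.toLinearMap
      = g ∘ₗ (WithLp.linearEquiv 2 ℂ (∀ i, E i)).symm.toLinearMap := by
    refine LinearMap.pi_ext fun i x => h i x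
  ext x
  exact LinearMap.congr_fun this (WithLp.linearEquiv 2 ℂ (∀ i, E i) x)

variable [Fintype ι]

/-- The linear map out of a direct sum given by its restrictions to the summands. -/
def desc {E : ι → FdHilb} {V : Type*} [AddCommMonoid V] [Module ℂ V]
    (f : ∀ i, E i →ₗ[ℂ] V) : DSum E →ₗ[ℂ] V := ∑ i, f i ∘ₗ proj E i

@[simp] theorem desc_incl {E : ι → FdHilb} {V : Type*} [AddCommMonoid V] [Module ℂ V]
    (f : ∀ i, E i →ₗ[ℂ] V) (i : ι) (x : E i) : desc f (incl E i x) = f i x := by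
  rw [desc, LinearMap.sum_apply, Finset.sum_eq_single i]
  · simp [proj_incl_same]
  · intro j _ h
    simp [proj_incl_ne E h]
  · simp

end DirectSum

/-- The tensor product of two finite-dimensional Hilbert spaces. -/
abbrev FdHilb.tensor (E F : FdHilb) : FdHilb := ⟨E ⊗[ℂ] F⟩

/-- The orthogonal direct sum of finitely many finite-dimensional Hilbert spaces. -/
abbrev FdHilb.sum {n : ℕ} (E : Fin n → FdHilb) : FdHilb := ⟨DSum E⟩

/-- The Hilbert space `ℂ`. -/
abbrev FdHilb.scalars : FdHilb := ⟨ℂ⟩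

/-- The Hilbert space which is `ℂ` if `p` holds and zero otherwise. -/
abbrev FdHilb.indicator (p : Prop) [Decidable p] : FdHilb := ⟨EuclideanSpace ℂ (PLift p)⟩

/-- An object `Hilb^n`. -/
structure Obj where
  dim : ℕ

/-- A 1-cell `Hilb^m ⟶ Hilb^n`: a matrix of Hilbert spaces. The first index belongs to the
source. -/
structure OneCell (A B : Obj) where
  entry : Fin A.dim → Fin B.dim → FdHilb

/-- A 2-cell: a matrix of linear maps. -/
@[ext] structure TwoCell {A B : Obj} (F G : OneCell A B) where
  map : ∀ i j, F.entry i j →ₗ[ℂ] G.entry i j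

instance : CategoryStruct Obj where
  Hom := OneCell
  id _ := ⟨fun i j => FdHilb.indicator (i = j)⟩
  comp {_ B _} F G :=
    ⟨fun i k => FdHilb.sum fun j : Fin B.dim => (F.entry i j).tensor (G.entry j k)⟩

instance (A B : Obj) : Category (A ⟶ B) where
  Hom F G := TwoCell F G
  id F := ⟨fun _ _ => LinearMap.id⟩
  comp η θ := ⟨fun i j => θ.map i j ∘ₗ η.map i j⟩


namespace OneCell

variable {A B C D E : Obj}

/-- The elementary tensor `x ⊗ y` in the `j`-th summand of an entry of a composite 1-cell, as a
bilinear map. -/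
def gen (F : A ⟶ B) (G : B ⟶ C) (i : Fin A.dim) (k : Fin C.dim) (j : Fin B.dim) :
    F.entry i j →ₗ[ℂ] G.entry j k →ₗ[ℂ] (F ≫ G).entry i k :=
  (TensorProduct.mk ℂ (F.entry i j) (G.entry j k)).compr₂
    (incl (fun j => (F.entry i j).tensor (G.entry j k)) j)

/-- The linear map out of an entry of a composite 1-cell given by a family of bilinear maps. -/
def lift {V : Type*} [AddCommMonoid V] [Module ℂ V] {F : A ⟶ B} {G : B ⟶ C} {i : Fin A.dim}
    {k : Fin C.dim} (f : ∀ j, F.entry i j →ₗ[ℂ] G.entry j k →ₗ[ℂ] V) :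
    (F ≫ G).entry i k →ₗ[ℂ] V :=
  desc (E := fun j => (F.entry i j).tensor (G.entry j k)) fun j => TensorProduct.lift (f j)

@[simp] theorem lift_gen {V : Type*} [AddCommMonoid V] [Module ℂ V] {F : A ⟶ B} {G : B ⟶ C}
    {i : Fin A.dim} {k : Fin C.dim} (f : ∀ j, F.entry i j →ₗ[ℂ] G.entry j k →ₗ[ℂ] V)
    (j : Fin B.dim) (x : F.entry i j) (y : G.entry j k) : lift f (gen F G i k j x y) = f j x y :=
  (desc_incl (E := fun j => (F.entry i j).tensor (G.entry j k)) _ j (x ⊗ₜ y)).trans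
    (TensorProduct.lift.tmul _ _)

theorem hom_ext {V : Type*} [AddCommMonoid V] [Module ℂ V] {F : A ⟶ B} {G : B ⟶ C}
    {i : Fin A.dim} {k : Fin C.dim} {f g : (F ≫ G).entry i k →ₗ[ℂ] V}
    (h : ∀ j x y, f (gen F G i k j x y) = g (gen F G i k j x y)) : f = g := by
  refine dsum_ext (E := fun j => (F.entry i j).tensor (G.entry j k)) fun j x => ?_
  have : f ∘ₗ incl (fun j => (F.entry i j).tensor (G.entry j k)) j
      = g ∘ₗ incl (fun j => (F.entry i j).tensor (G.entry j k)) j :=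
    TensorProduct.ext' fun x y => h j x y
  exact LinearMap.congr_fun this x

theorem hom_ext_left {V : Type*} [AddCommMonoid V] [Module ℂ V] {F : A ⟶ B} {G : B ⟶ C}
    {H : C ⟶ D} {i : Fin A.dim} {l : Fin D.dim} {f g : ((F ≫ G) ≫ H).entry i l →ₗ[ℂ] V}
    (h : ∀ k j x y z, f (gen (F ≫ G) H i l k (gen F G i k j x y) z)
      = g (gen (F ≫ G) H i l k (gen F G i k j x y) z)) : f = g := by
  refine hom_ext fun k u z => ?_
  have : f ∘ₗ (gen (F ≫ G) H i l k).flip z = g ∘ₗ (gen (F ≫ G) H i l k).flip z :=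
    hom_ext fun j x y => h k j x y z
  exact LinearMap.congr_fun this u

theorem hom_ext_right {V : Type*} [AddCommMonoid V] [Module ℂ V] {F : A ⟶ B} {G : B ⟶ C}
    {H : C ⟶ D} {i : Fin A.dim} {l : Fin D.dim} {f g : (F ≫ G ≫ H).entry i l →ₗ[ℂ] V}
    (h : ∀ j k x y z, f (gen F (G ≫ H) i l j x (gen G H j l k y z))
      = g (gen F (G ≫ H) i l j x (gen G H j l k y z))) : f = g := by
  refine hom_ext fun j x u => ?_
  have : f ∘ₗ gen F (G ≫ H) i l j x = g ∘ₗ gen F (G ≫ H) i l j x :=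
    hom_ext fun k y z => h j k x y z
  exact LinearMap.congr_fun this u

theorem hom_ext_left₂ {V : Type*} [AddCommMonoid V] [Module ℂ V] {F : A ⟶ B} {G : B ⟶ C}
    {H : C ⟶ D} {K : D ⟶ E} {i : Fin A.dim} {m : Fin E.dim}
    {f g : (((F ≫ G) ≫ H) ≫ K).entry i m →ₗ[ℂ] V}
    (h : ∀ l k j x y z w,
      f (gen ((F ≫ G) ≫ H) K i m l (gen (F ≫ G) H i l k (gen F G i k j x y) z) w)
      = g (gen ((F ≫ G) ≫ H) K i m l (gen (F ≫ G) H i l k (gen F G i k j x y) z) w)) :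
    f = g := by
  refine hom_ext fun l u w => ?_
  have : f ∘ₗ (gen ((F ≫ G) ≫ H) K i m l).flip w = g ∘ₗ (gen ((F ≫ G) ≫ H) K i m l).flip w :=
    hom_ext_left fun k j x y z => h l k j x y z w
  exact LinearMap.congr_fun this u

end OneCell

namespace TwoCell

open OneCell

variable {A B C D : Obj}

theorem hom_ext {F G : A ⟶ B} {η θ : F ⟶ G} (h : ∀ i j, TwoCell.map η i j = TwoCell.map θ i j) :
    η = θ :=
  TwoCell.ext (funext fun i => funext fun j => h i j)

@[simp] theorem id_map (F : A ⟶ B) (i j) : TwoCell.map (𝟙 F) i j = LinearMap.id := rfl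

@[simp] theorem comp_map {F G H : A ⟶ B} (η : F ⟶ G) (θ : G ⟶ H) (i j) :
    TwoCell.map (η ≫ θ) i j = TwoCell.map θ i j ∘ₗ TwoCell.map η i j := rfl

/-- Whiskering on the left: `x ⊗ y ↦ x ⊗ η y`. -/
def whiskerLeft (F : A ⟶ B) {G H : B ⟶ C} (η : G ⟶ H) : F ≫ G ⟶ F ≫ H :=
  TwoCell.mk fun i k => lift fun j => (gen F H i k j).compl₂ (TwoCell.map η j k)

/-- Whiskering on the right: `x ⊗ y ↦ η x ⊗ y`. -/
def whiskerRight {F G : A ⟶ B} (η : F ⟶ G) (H : B ⟶ C) : F ≫ H ⟶ G ≫ H :=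
  TwoCell.mk fun i k => lift fun j => (gen G H i k j) ∘ₗ (TwoCell.map η i j)

@[simp] theorem whiskerLeft_gen (F : A ⟶ B) {G H : B ⟶ C} (η : G ⟶ H) (i k j x y) :
    (whiskerLeft F η).map i k (gen F G i k j x y) = gen F H i k j x (TwoCell.map η j k y) := by
  simp [whiskerLeft]

@[simp] theorem whiskerRight_gen {F G : A ⟶ B} (η : F ⟶ G) (H : B ⟶ C) (i k j x y) :
    (whiskerRight η H).map i k (gen F H i k j x y) = gen G H i k j (TwoCell.map η i j x) y := by
  simp [whiskerRight]

/-- `(x ⊗ y) ⊗ z ↦ x ⊗ (y ⊗ z)`. -/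
def assocHom (F : A ⟶ B) (G : B ⟶ C) (H : C ⟶ D) : (F ≫ G) ≫ H ⟶ F ≫ G ≫ H :=
  TwoCell.mk fun i l => lift fun k => lift fun j =>
    (LinearMap.llcomp ℂ _ _ _ ∘ₗ gen F (G ≫ H) i l j).compl₂ (gen G H j l k)

/-- `x ⊗ (y ⊗ z) ↦ (x ⊗ y) ⊗ z`. -/
def assocInv (F : A ⟶ B) (G : B ⟶ C) (H : C ⟶ D) : F ≫ G ≫ H ⟶ (F ≫ G) ≫ H :=
  TwoCell.mk fun i l => lift fun j => LinearMap.flip <| lift fun k =>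
    ((LinearMap.llcomp ℂ _ _ _ ∘ₗ (gen (F ≫ G) H i l k).flip).compl₂ (gen F G i k j).flip).flip

@[simp] theorem assocHom_gen (F : A ⟶ B) (G : B ⟶ C) (H : C ⟶ D) (i l k j x y z) :
    (assocHom F G H).map i l (gen (F ≫ G) H i l k (gen F G i k j x y) z)
      = gen F (G ≫ H) i l j x (gen G H j l k y z) := by
  simp [assocHom]

@[simp] theorem assocInv_gen (F : A ⟶ B) (G : B ⟶ C) (H : C ⟶ D) (i l k j x y z) :
    (assocInv F G H).map i l (gen F (G ≫ H) i l j x (gen G H j l k y z))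
      = gen (F ≫ G) H i l k (gen F G i k j x y) z := by
  simp [assocInv]

/-- The element `1` of a diagonal entry `ℂ` of an identity 1-cell. -/
def idOne (A : Obj) (i : Fin A.dim) : OneCell.entry (𝟙 A) i i :=
  EuclideanSpace.single (PLift.up (rfl : i = i)) (1 : ℂ)

/-- The linear map out of an entry of an identity 1-cell with a prescribed value at `1` for
diagonal entries; off the diagonal the domain is zero. -/
def idLift {V : Type*} [AddCommMonoid V] [Module ℂ V] {A : Obj} {i j : Fin A.dim}
    (f : i = j → V) : OneCell.entry (𝟙 A) i j →ₗ[ℂ] V :=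
  ∑ p : PLift (i = j), (EuclideanSpace.projₗ p).smulRight (f p.down)

@[simp] theorem idLift_one {V : Type*} [AddCommMonoid V] [Module ℂ V] {A : Obj} {i : Fin A.dim}
    (f : i = i → V) : idLift f (idOne A i) = f rfl := by
  have : (Finset.univ : Finset (PLift (i = i))) = {⟨rfl⟩} := by
    ext ⟨⟩; simp
  have h : EuclideanSpace.projₗ (𝕜 := ℂ) (PLift.up (rfl : i = i)) (idOne A i) = 1 := by
    simp [idOne, PiLp.projₗ]
  simp [idLift, this, h]

theorem id_hom_ext {V : Type*} [AddCommMonoid V] [Module ℂ V] {A : Obj} {i j : Fin A.dim}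
    {f g : OneCell.entry (𝟙 A) i j →ₗ[ℂ] V}
    (h : ∀ p : i = j, f (p ▸ idOne A i) = g (p ▸ idOne A i)) : f = g := by
  refine (EuclideanSpace.basisFun (PLift (i = j)) ℂ).toBasis.ext fun p => ?_
  obtain ⟨rfl⟩ := p
  rw [OrthonormalBasis.coe_toBasis, EuclideanSpace.basisFun_apply]
  exact h rfl

theorem id_comp_ext {V : Type*} [AddCommMonoid V] [Module ℂ V] {F : A ⟶ B}
    {i : Fin A.dim} {k : Fin B.dim} {f g : (𝟙 A ≫ F).entry i k →ₗ[ℂ] V}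
    (h : ∀ y, f (gen (𝟙 A) F i k i (idOne A i) y) = g (gen (𝟙 A) F i k i (idOne A i) y)) :
    f = g := by
  refine OneCell.hom_ext fun j x y => ?_
  have : f ∘ₗ (gen (𝟙 A) F i k j).flip y = g ∘ₗ (gen (𝟙 A) F i k j).flip y := by
    refine id_hom_ext fun p => ?_
    subst p
    exact h y
  exact LinearMap.congr_fun this x

theorem comp_id_ext {V : Type*} [AddCommMonoid V] [Module ℂ V] {F : A ⟶ B}
    {i : Fin A.dim} {k : Fin B.dim} {f g : (F ≫ 𝟙 B).entry i k →ₗ[ℂ] V}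
    (h : ∀ x, f (gen F (𝟙 B) i k k x (idOne B k)) = g (gen F (𝟙 B) i k k x (idOne B k))) :
    f = g := by
  refine OneCell.hom_ext fun j x y => ?_
  have : f ∘ₗ (gen F (𝟙 B) i k j) x = g ∘ₗ (gen F (𝟙 B) i k j) x := by
    refine id_hom_ext fun p => ?_
    subst p
    exact h x
  exact LinearMap.congr_fun this y

/-- `1 ⊗ y ↦ y`. -/
def leftUnitHom (F : A ⟶ B) : 𝟙 A ≫ F ⟶ F :=
  TwoCell.mk fun _ _ => lift fun _ => idLift fun p => p ▸ LinearMap.id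

/-- `y ↦ 1 ⊗ y`. -/
def leftUnitInv (F : A ⟶ B) : F ⟶ 𝟙 A ≫ F :=
  TwoCell.mk fun i _ => gen (𝟙 A) F i _ i (idOne A i)

/-- `x ⊗ 1 ↦ x`. -/
def rightUnitHom (F : A ⟶ B) : F ≫ 𝟙 B ⟶ F :=
  TwoCell.mk fun _ _ => lift fun _ =>
    LinearMap.flip <| idLift fun p => p ▸ LinearMap.id

/-- `x ↦ x ⊗ 1`. -/
def rightUnitInv (F : A ⟶ B) : F ⟶ F ≫ 𝟙 B :=
  TwoCell.mk fun _ k => (gen F (𝟙 B) _ k k).flip (idOne B k)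

@[simp] theorem leftUnitHom_gen (F : A ⟶ B) (i k y) :
    (leftUnitHom F).map i k (gen (𝟙 A) F i k i (idOne A i) y) = y := by
  simp [leftUnitHom]

@[simp] theorem rightUnitHom_gen (F : A ⟶ B) (i k x) :
    (rightUnitHom F).map i k (gen F (𝟙 B) i k k x (idOne B k)) = x := by
  simp [rightUnitHom]

@[simp] theorem leftUnitInv_apply (F : A ⟶ B) (i k y) :
    (leftUnitInv F).map i k y = gen (𝟙 A) F i k i (idOne A i) y := rfl

@[simp] theorem rightUnitInv_apply (F : A ⟶ B) (i k x) :
    (rightUnitInv F).map i k x = gen F (𝟙 B) i k k x (idOne B k) := rfl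

end TwoCell

open OneCell TwoCell in
/-- The 2-category of finite-dimensional 2-Hilbert spaces, in matrix form. -/
instance : Bicategory Obj where
  whiskerLeft F _ _ η := TwoCell.whiskerLeft F η
  whiskerRight η H := TwoCell.whiskerRight η H
  associator F G H :=
    { hom := assocHom F G H
      inv := assocInv F G H
      hom_inv_id := by
        apply TwoCell.hom_ext; intros; apply OneCell.hom_ext_left; intros; simp
      inv_hom_id := by
        apply TwoCell.hom_ext; intros; apply OneCell.hom_ext_right; intros; simp }
  leftUnitor F :=
    { hom := leftUnitHom F
      inv := leftUnitInv F
      hom_inv_id := by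
        apply TwoCell.hom_ext; intros; apply id_comp_ext; intros; simp
      inv_hom_id := by
        apply TwoCell.hom_ext; intros; apply LinearMap.ext; intros; simp }
  rightUnitor F :=
    { hom := rightUnitHom F
      inv := rightUnitInv F
      hom_inv_id := by
        apply TwoCell.hom_ext; intros; apply comp_id_ext; intros; simp
      inv_hom_id := by
        apply TwoCell.hom_ext; intros; apply LinearMap.ext; intros; simp }
  whiskerLeft_id _ _ := by
    apply TwoCell.hom_ext; intros; apply OneCell.hom_ext; intros; simp
  whiskerLeft_comp _ _ _ _ _ _ := by
    apply TwoCell.hom_ext; intros; apply OneCell.hom_ext; intros; simp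
  id_whiskerLeft _ := by
    apply TwoCell.hom_ext; intros; apply id_comp_ext; intros; simp
  comp_whiskerLeft _ _ _ _ _ := by
    apply TwoCell.hom_ext; intros; apply OneCell.hom_ext_left; intros; simp
  id_whiskerRight _ _ := by
    apply TwoCell.hom_ext; intros; apply OneCell.hom_ext; intros; simp
  comp_whiskerRight _ _ _ := by
    apply TwoCell.hom_ext; intros; apply OneCell.hom_ext; intros; simp
  whiskerRight_id _ := by
    apply TwoCell.hom_ext; intros; apply comp_id_ext; intros; simp
  whiskerRight_comp _ _ _ := by
    apply TwoCell.hom_ext; intros; apply OneCell.hom_ext_right; intros; simp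
  whisker_assoc _ _ _ _ _ := by
    apply TwoCell.hom_ext; intros; apply OneCell.hom_ext_left; intros; simp
  whisker_exchange _ _ := by
    apply TwoCell.hom_ext; intros; apply OneCell.hom_ext; intros; simp
  pentagon _ _ _ _ := by
    apply TwoCell.hom_ext; intros; apply OneCell.hom_ext_left₂; intros; simp
  triangle F G := by
    apply TwoCell.hom_ext; intro i k; apply OneCell.hom_ext; intro j u y
    have : (((assocHom F (𝟙 _) G ≫ TwoCell.whiskerLeft F (leftUnitHom G)).map i k) ∘ₗ
        (gen (F ≫ 𝟙 _) G i k j).flip y) = ((TwoCell.whiskerRight (rightUnitHom F) G).map i k) ∘ₗ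
        (gen (F ≫ 𝟙 _) G i k j).flip y := comp_id_ext fun x => by simp
    exact LinearMap.congr_fun this u

section Dagger

variable {A B : Obj} {F G : A ⟶ B}

/-- The reversal of a 2-cell: the matrix of adjoint maps. -/
def dagger (η : F ⟶ G) : G ⟶ F :=
  TwoCell.mk fun i j => LinearMap.adjoint (TwoCell.map η i j)

/-- A 2-cell is (vertically) unitary. -/
def IsUnitary (η : F ⟶ G) : Prop :=
  η ≫ dagger η = 𝟙 F ∧ dagger η ≫ η = 𝟙 G

/-- The multiple of a 2-cell by a scalar. -/
def scale (c : ℂ) (η : F ⟶ G) : F ⟶ G :=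
  TwoCell.mk fun i j => c • TwoCell.map η i j

end Dagger

/-- The object `Hilb^n`, the store of a piece of classical data with `n` values. -/
abbrev cl (n : ℕ) : Obj := ⟨n⟩

/-- The monoidal unit `Hilb`. -/
abbrev unitObj : Obj := ⟨1⟩

/-- The witness `Hilb ⟶ Hilb^n`, all of whose entries are `ℂ`. -/
def witIn (n : ℕ) : unitObj ⟶ cl n := OneCell.mk fun _ _ => FdHilb.scalars

/-- The witness `Hilb^n ⟶ Hilb`, all of whose entries are `ℂ`. -/
def witOut (n : ℕ) : cl n ⟶ unitObj := OneCell.mk fun _ _ => FdHilb.scalars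

/-- A number as an element of an entry of `witIn n`. -/
def inVal (n : ℕ) (i : Fin 1) (k : Fin n) : ℂ →ₗ[ℂ] (witIn n).entry i k := LinearMap.id

/-- A number as an element of an entry of `witOut n`. -/
def outVal (n : ℕ) (k : Fin n) (i : Fin 1) : ℂ →ₗ[ℂ] (witOut n).entry k i := LinearMap.id

theorem inner_inVal (n i k) (a b : ℂ) :
    inner ℂ (inVal n i k a) (inVal n i k b) = b * starRingEnd ℂ a := rfl

theorem inner_outVal (n k i) (a b : ℂ) :
    inner ℂ (outVal n k i a) (outVal n k i b) = b * starRingEnd ℂ a := rfl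

open OneCell TwoCell

/-- Copying classical data: `1 ↦ 1 ⊗ 1` on the diagonal, zero off the diagonal. -/
def copy (n : ℕ) : 𝟙 (cl n) ⟶ witOut n ≫ witIn n :=
  TwoCell.mk fun i j => idLift fun _ => 
    gen (witOut n) (witIn n) i j 0 (outVal n i 0 1) (inVal n 0 j 1)

/-- Creating uniform classical data: `1 ↦ ∑ k, 1 ⊗ 1`. -/
def create (n : ℕ) : 𝟙 unitObj ⟶ witIn n ≫ witOut n :=
  TwoCell.mk fun i j => idLift fun _ => 
    ∑ k, gen (witIn n) (witOut n) i j k (inVal n i k 1) (outVal n k j 1)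

/-- Comparing classical data. -/
def compare (n : ℕ) : witOut n ≫ witIn n ⟶ 𝟙 (cl n) := dagger (copy n)

/-- Deleting classical data. -/
def delete (n : ℕ) : witIn n ≫ witOut n ⟶ 𝟙 unitObj := dagger (create n)

theorem inner_gen {A B C : Obj} (F : A ⟶ B) (G : B ⟶ C) (i k j j') (x : F.entry i j)
    (y : G.entry j k) (x' : F.entry i j') (y' : G.entry j' k) :
    inner ℂ (gen F G i k j x y) (gen F G i k j' x' y')
      = if h : j' = j then inner ℂ x (h ▸ x') * inner ℂ y (h ▸ y') else 0 := by
  have e : ∀ (j : Fin B.dim) (x : F.entry i j) (y : G.entry j k), gen F G i k j x y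
      = PiLp.single 2 (β := fun j => (((F.entry i j).tensor (G.entry j k)) : Type)) j (x ⊗ₜ[ℂ] y) :=
    fun _ _ _ => rfl
  rw [e, e, PiLp.inner_apply]
  split_ifs with h
  · subst h
    rw [Finset.sum_eq_single j']
    · simp
    · intro l _ hl
      simp [hl]
    · simp
  · refine Finset.sum_eq_zero fun l _ => ?_
    by_cases hl : l = j
    · subst hl
      simp [Ne.symm h]
    · simp [hl]

theorem idOne_inner (A : Obj) (i : Fin A.dim) : inner ℂ (idOne A i) (idOne A i) = (1 : ℂ) := by
  refine (EuclideanSpace.inner_single_left (𝕜 := ℂ) (PLift.up (rfl : i = i)) 1 _).trans ?_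
  simp [idOne]

theorem id_entry_ext {A : Obj} {i j : Fin A.dim} {v w : OneCell.entry (𝟙 A) i j}
    (h : ∀ p : i = j, inner ℂ (p ▸ idOne A i) v = inner ℂ (p ▸ idOne A i) w) : v = w := by
  refine ext_inner_left ℂ fun u => ?_
  have key : ∀ z : OneCell.entry (𝟙 A) i j, ∀ p : i = j, ∀ u : OneCell.entry (𝟙 A) i j,
      u = (inner ℂ (p ▸ idOne A i) u : ℂ) • (p ▸ idOne A i : OneCell.entry (𝟙 A) i j) := by
    rintro z rfl u
    refine PiLp.ext fun q => ?_
    obtain ⟨q⟩ := q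
    have := EuclideanSpace.inner_single_left (𝕜 := ℂ) (PLift.up (rfl : i = i)) 1 u
    change u.ofLp ⟨q⟩ = (inner ℂ (EuclideanSpace.single (PLift.up (rfl : i = i)) (1 : ℂ)) u •
      EuclideanSpace.single (PLift.up (rfl : i = i)) (1 : ℂ)).ofLp ⟨q⟩
    rw [this]
    simp
  by_cases p : i = j
  · rw [key v p u, inner_smul_left, inner_smul_left, h p]
  · have : u = 0 := PiLp.ext fun q => absurd q.down p
    simp [this]

theorem compare_same (n : ℕ) (i : Fin n) (a b : ℂ) :
    (compare n).map i i (gen (witOut n) (witIn n) i i 0 (outVal n i 0 a) (inVal n 0 i b)) = (a * b) • idOne (cl n) i := by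
  refine id_entry_ext fun p => ?_
  have : (compare n).map i i = LinearMap.adjoint ((copy n).map i i) := rfl
  rw [this, LinearMap.adjoint_inner_right, inner_smul_right]
  have h1 : (copy n).map i i (idOne (cl n) i) = 
      gen (witOut n) (witIn n) i i 0 (outVal n i 0 1) (inVal n 0 i 1) := by
    simp [copy]
  rw [h1, inner_gen, idOne_inner]
  simp [inner_outVal, inner_inVal]

theorem compare_ne (n : ℕ) {i j : Fin n} (h : i ≠ j) (x) : (compare n).map i j x = 0 :=
  id_entry_ext fun p => absurd p h

theorem delete_gen (n : ℕ) (i : Fin 1) (k : Fin n) (a b : ℂ) :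
    (delete n).map i i (gen (witIn n) (witOut n) i i k (inVal n i k a) (outVal n k i b)) = (a * b) • idOne unitObj i := by
  refine id_entry_ext fun p => ?_
  have : (delete n).map i i = LinearMap.adjoint ((create n).map i i) := rfl
  rw [this, LinearMap.adjoint_inner_right, inner_smul_right]
  have h1 : (create n).map i i (idOne unitObj i)
      = ∑ k, gen (witIn n) (witOut n) i i k (inVal n i k 1) (outVal n k i 1) := by
    simp [create]
  rw [h1, sum_inner, idOne_inner, Finset.sum_eq_single k]
  · rw [inner_gen]
    simp [inner_outVal, inner_inVal]
  · intro l _ hl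
    rw [inner_gen, dif_neg (Ne.symm hl)]
  · simp

@[simp] theorem whiskerLeft_eq {A B C : Obj} (F : A ⟶ B) {G H : B ⟶ C} (η : G ⟶ H) :
    F ◁ η = TwoCell.whiskerLeft F η := rfl

@[simp] theorem whiskerRight_eq {A B C : Obj} {F G : A ⟶ B} (η : F ⟶ G) (H : B ⟶ C) :
    η ▷ H = TwoCell.whiskerRight η H := rfl

@[simp] theorem associator_hom_eq {A B C D : Obj} (F : A ⟶ B) (G : B ⟶ C) (H : C ⟶ D) :
    (α_ F G H).hom = assocHom F G H := rfl

@[simp] theorem associator_inv_eq {A B C D : Obj} (F : A ⟶ B) (G : B ⟶ C) (H : C ⟶ D) :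
    (α_ F G H).inv = assocInv F G H := rfl

@[simp] theorem leftUnitor_hom_eq {A B : Obj} (F : A ⟶ B) : (λ_ F).hom = leftUnitHom F := rfl

@[simp] theorem leftUnitor_inv_eq {A B : Obj} (F : A ⟶ B) : (λ_ F).inv = leftUnitInv F := rfl

@[simp] theorem rightUnitor_hom_eq {A B : Obj} (F : A ⟶ B) : (ρ_ F).hom = rightUnitHom F := rfl

@[simp] theorem rightUnitor_inv_eq {A B : Obj} (F : A ⟶ B) : (ρ_ F).inv = rightUnitInv F := rfl

/-- Creation and comparison exhibit one witness as right dual to the other. -/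
def adjIn (n : ℕ) : witIn n ⊣ witOut n where
  unit := create n
  counit := compare n
  left_triangle := by
    apply TwoCell.hom_ext; intro i k; apply id_comp_ext; intro y
    obtain ⟨y, rfl⟩ : ∃ c, inVal n i k c = y := ⟨y, rfl⟩
    simp [leftZigzag, bicategoricalComp, create]
    rw [Finset.sum_eq_single k]
    · obtain rfl : i = 0 := Subsingleton.elim _ _
      rw [compare_same]
      simp only [map_smul, one_mul]
      rw [← LinearMap.smul_apply, ← map_smul, ← map_smul, smul_eq_mul, mul_one]
    · intro j _ hj
      rw [compare_ne n hj, map_zero]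
    · simp
  right_triangle := by
    apply TwoCell.hom_ext; intro i k; apply comp_id_ext; intro y
    obtain ⟨y, rfl⟩ : ∃ c, outVal n i k c = y := ⟨y, rfl⟩
    simp [rightZigzag, bicategoricalComp, create]
    rw [Finset.sum_eq_single i]
    · obtain rfl : k = 0 := Subsingleton.elim _ _
      rw [compare_same]
      simp only [map_smul, mul_one, LinearMap.smul_apply]
      rw [← map_smul, ← map_smul, smul_eq_mul, mul_one]
    · intro j _ hj
      rw [compare_ne n (Ne.symm hj), map_zero, LinearMap.zero_apply]
    · simp

/-- Copying and deletion exhibit one witness as right dual to the other. -/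
def adjOut (n : ℕ) : witOut n ⊣ witIn n where
  unit := copy n
  counit := delete n
  left_triangle := by
    apply TwoCell.hom_ext; intro i k; apply id_comp_ext; intro y
    obtain ⟨y, rfl⟩ : ∃ c, outVal n i k c = y := ⟨y, rfl⟩
    simp [leftZigzag, bicategoricalComp, copy]
    obtain rfl : k = 0 := Subsingleton.elim _ _
    rw [delete_gen]
    simp only [map_smul, one_mul]
    rw [← LinearMap.smul_apply, ← map_smul, ← map_smul, smul_eq_mul, mul_one]
  right_triangle := by
    apply TwoCell.hom_ext; intro i k; apply comp_id_ext; intro y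
    obtain ⟨y, rfl⟩ : ∃ c, inVal n i k c = y := ⟨y, rfl⟩
    simp [rightZigzag, bicategoricalComp, copy]
    obtain rfl : i = 0 := Subsingleton.elim _ _
    rw [delete_gen]
    simp only [map_smul, mul_one, LinearMap.smul_apply]
    rw [← map_smul, ← map_smul, smul_eq_mul, mul_one]

/-- A nondegenerate measurement with `n` outcomes of the system `H`. -/
structure Measurement (H : unitObj ⟶ unitObj) (n : ℕ) where
  cell : H ⟶ witIn n ≫ witOut n
  unitary : IsUnitary cell

/-- The linear isometry `H ≃ ℂ^n` given by a nondegenerate measurement. -/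
def Measurement.repr {H : unitObj ⟶ unitObj} {n : ℕ} (M : Measurement H n) :
    H.entry 0 0 ≃ₗᵢ[ℂ] EuclideanSpace ℂ (Fin n) :=
  let e : H.entry 0 0 ≃ₗ[ℂ] (witIn n ≫ witOut n).entry 0 0 :=
    LinearEquiv.ofLinearMap (TwoCell.map M.cell 0 0) (TwoCell.map (dagger M.cell) 0 0)
      (congrArg (fun η : witIn n ≫ witOut n ⟶ witIn n ≫ witOut n => TwoCell.map η 0 0) M.unitary.2)
      (congrArg (fun η : H ⟶ H => TwoCell.map η 0 0) M.unitary.1)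
  (e.isometryOfInner fun x y => by
    change inner ℂ (TwoCell.map M.cell 0 0 x) (TwoCell.map M.cell 0 0 y) = _
    rw [← LinearMap.adjoint_inner_right]
    exact congrArg (inner ℂ x) (e.symm_apply_apply y)).trans
  (LinearIsometryEquiv.piLpCongrRight 2 fun _ : Fin n => TensorProduct.lidIsometry ℂ ℂ)

/-- The orthonormal basis of the Hilbert space of the system given by a nondegenerate measurement:
its `i`-th vector is the state which the measurement sends to the `i`-th outcome. -/
def Measurement.basis {H : unitObj ⟶ unitObj} {n : ℕ} (M : Measurement H n) :
    OrthonormalBasis (Fin n) ℂ (H.entry 0 0) :=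
  OrthonormalBasis.ofRepr M.repr

/-- Two orthonormal bases of a Hilbert space are complementary. -/
def AreComplementary {ι V : Type*} [Fintype ι] [NormedAddCommGroup V] [InnerProductSpace ℂ V]
    (a b : OrthonormalBasis ι ℂ V) : Prop :=
  ∀ i j, ‖inner ℂ (a i) (b j)‖ ^ 2 = 1 / (Module.finrank ℂ V : ℝ)

section Complementarity

variable {H : unitObj ⟶ unitObj} {n : ℕ}

/-- The preparation-measurement composite: encode classical data using the red measurement, then
measure using the green one. -/
def prepMeasure (red green : Measurement H n) : witIn n ≫ witOut n ⟶ witIn n ≫ witOut n :=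
  dagger red.cell ≫ green.cell

/-- Measure in red, copy the outcome, encode the second copy using red, and measure in green. -/
def sequentialMeasurement (red green : Measurement H n) :
    H ⟶ (witIn n ≫ witOut n) ≫ witIn n ≫ witOut n :=
  red.cell ≫ witIn n ◁ ((λ_ (witOut n)).inv ≫ copy n ▷ witOut n ≫ (α_ _ _ _).hom) ≫
    (α_ _ _ _).inv ≫ (witIn n ≫ witOut n) ◁ prepMeasure red green

/-- Measure in red, create uniform classical data, and apply a controlled phase. -/
def phasedMeasurement (red : Measurement H n) (φ : witOut n ≫ witIn n ⟶ witOut n ≫ witIn n) :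
    H ⟶ (witIn n ≫ witOut n) ≫ witIn n ≫ witOut n :=
  red.cell ≫ witIn n ◁ ((ρ_ (witOut n)).inv ≫ witOut n ◁ create n ≫ (α_ _ _ _).inv ≫
    φ ▷ witOut n ≫ (α_ _ _ _).hom) ≫ (α_ _ _ _).inv

/-- Up to a controlled phase, a red measurement and a subsequent green measurement have
uncorrelated outcomes. -/
def PhysicallyComplementary (red green : Measurement H n) : Prop :=
  ∃ φ : witOut n ≫ witIn n ⟶ witOut n ≫ witIn n, IsUnitary φ ∧
    sequentialMeasurement red green = scale ((1 / √(n : ℝ) : ℝ) : ℂ) (phasedMeasurement red φ)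

end Complementarity

/-- A 2-cell `H ≫ J ⟶ F ≫ G` is horizontally unitary, with respect to given right duals of `F` and
`J`, if the 2-cell `F' ≫ H ⟶ G ≫ J'` is unitary which arises by bending `F` down with the
counit `F' ≫ F ⟶ 𝟙` and `J` up with the unit `𝟙 ⟶ J ≫ J'`. -/
def IsHorizontallyUnitary {a b c d : Obj} {F : a ⟶ b} {F' : b ⟶ a} {J : c ⟶ d} {J' : d ⟶ c}
    (adjF : F ⊣ F') (adjJ : J ⊣ J') {H : a ⟶ c} {G : b ⟶ d} (f : H ≫ J ⟶ F ≫ G) : Prop :=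
  IsUnitary (mateEquiv adjF adjJ f)

end TwoHilbert

end

/-! All three conditions reduce to one statement about the transition matrix: `‖⟪green l, red k⟫‖ ^
2 = 1 / n` for all `l`, `k`. In the outcome basis the preparation–measurement composite is this
matrix, acting on an `n`-dimensional space. Every entry of `witOut n ≫ witIn n` is a line, so a
2-cell on it is just an `n × n` array of scalars (`exists_eq_phase`), and it is unitary exactly when
all of them have modulus one (`isUnitary_phase`). Bending wires turns the matrix into the array of
its own entries (`mateEquiv_eq_phase`): the same numbers must now be unimodular one by one, after
the rescaling by `c`. For horizontal unitarity this says that the matrix entries have constant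
modulus, and Parseval's identity fixes that modulus. For physical complementarity, evaluating both
protocols on a red basis vector and comparing coefficients expresses the transition matrix as `1 /
√n` times the phases. Vertical unitarity holds because unitaries are closed under adjoints and
composition. -/

namespace TwoHilbert

open OneCell TwoCell

/-! ### One-dimensional entries and controlled phases. -/

/-- The state of the system `witIn n ≫ witOut n` which carries the outcome `k`. -/
noncomputable def outcome (n : ℕ) (k : Fin n) : OneCell.entry (witIn n ≫ witOut n) 0 0 :=
  gen (witIn n) (witOut n) 0 0 k (inVal n 0 k 1) (outVal n k 0 1)

/-- The basis vector of an entry of `witOut n ≫ witIn n`. -/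
noncomputable def regionOne (n : ℕ) (i j : Fin n) : OneCell.entry (witOut n ≫ witIn n) i j :=
  gen (witOut n) (witIn n) i j 0 (outVal n i 0 1) (inVal n 0 j 1)

theorem regionOne_ext {n : ℕ} {i j : Fin n} {V : Type*} [AddCommMonoid V] [Module ℂ V]
    {f g : OneCell.entry (witOut n ≫ witIn n) i j →ₗ[ℂ] V}
    (h : f (regionOne n i j) = g (regionOne n i j)) : f = g := by
  -- Entries of the witnesses unfold to `ℂ`, so any elementary tensor is a multiple of `1 ⊗ 1`.
  refine OneCell.hom_ext fun k (x : ℂ) (y : ℂ) => ?_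
  obtain rfl : k = 0 := Subsingleton.elim _ _
  have e : gen (witOut n) (witIn n) i j 0 x y = (x * y) • regionOne n i j := by
    change gen (witOut n) (witIn n) i j 0 (outVal n i 0 x) (inVal n 0 j y) = _
    rw [← mul_one x, ← mul_one y, ← smul_eq_mul x, ← smul_eq_mul y, map_smul, map_smul, map_smul,
      map_smul, LinearMap.smul_apply, smul_smul]
    simp only [smul_eq_mul, mul_one, mul_comm, regionOne]
  rw [e, map_smul, map_smul, h]

theorem inner_regionOne (n : ℕ) (i j : Fin n) :
    inner ℂ (regionOne n i j) (regionOne n i j) = (1 : ℂ) := by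
  rw [regionOne, inner_gen]
  rw [dif_pos rfl, inner_outVal, inner_inVal]
  simp

theorem regionOne_ne_zero (n : ℕ) (i j : Fin n) : regionOne n i j ≠ 0 := fun h => by
  simpa [h] using inner_regionOne n i j

theorem eq_smul_regionOne {n : ℕ} {i j : Fin n} (v : OneCell.entry (witOut n ≫ witIn n) i j) :
    v = (inner ℂ (regionOne n i j) v : ℂ) • regionOne n i j := by
  have : (LinearMap.id : OneCell.entry (witOut n ≫ witIn n) i j →ₗ[ℂ] _) =
      (innerₛₗ ℂ (regionOne n i j)).smulRight (regionOne n i j) :=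
    regionOne_ext (by
      rw [LinearMap.smulRight_apply, innerₛₗ_apply_apply, inner_regionOne, one_smul,
        LinearMap.id_apply])
  exact LinearMap.congr_fun this v

/-- The 2-cell of `witOut n ≫ witIn n` which multiplies the entries by given scalars. -/
noncomputable def phase {n : ℕ} (u : Fin n → Fin n → ℂ) : witOut n ≫ witIn n ⟶ witOut n ≫ witIn n :=
  TwoCell.mk fun i j => u i j • LinearMap.id

/-- An endomorphism of a line is a scalar, namely its matrix coefficient at the unit vector
`regionOne`. -/
theorem exists_eq_phase {n : ℕ} (φ : witOut n ≫ witIn n ⟶ witOut n ≫ witIn n) :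
    ∃ u, φ = phase u := by
  refine ⟨fun i j => inner ℂ (regionOne n i j) (TwoCell.map φ i j (regionOne n i j)), ?_⟩
  refine TwoCell.hom_ext fun i j => regionOne_ext ?_
  exact eq_smul_regionOne _

theorem phase_map {n : ℕ} (u : Fin n → Fin n → ℂ) (i j x) :
    TwoCell.map (phase u) i j x = u i j • x := rfl

theorem dagger_phase_map {n : ℕ} (u : Fin n → Fin n → ℂ) (i j x) :
    TwoCell.map (dagger (phase u)) i j x = starRingEnd ℂ (u i j) • x := by
  refine ext_inner_left ℂ fun y => ?_
  change inner ℂ y (LinearMap.adjoint (TwoCell.map (phase u) i j) x) = _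
  rw [LinearMap.adjoint_inner_right, phase_map, inner_smul_left, inner_smul_right]

theorem isUnitary_phase {n : ℕ} (u : Fin n → Fin n → ℂ) :
    IsUnitary (phase u) ↔ ∀ i j, ‖u i j‖ ^ 2 = 1 := by
  have key : ∀ i j, (starRingEnd ℂ (u i j) * u i j = 1 ↔ ‖u i j‖ ^ 2 = 1) := fun i j => by
    rw [Complex.conj_mul']
    exact_mod_cast Iff.rfl
  constructor
  · intro h i j
    have := congrArg (fun η : witOut n ≫ witIn n ⟶ witOut n ≫ witIn n =>
      TwoCell.map η i j (regionOne n i j)) h.1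
    simp only [comp_map, id_map, LinearMap.comp_apply, LinearMap.id_apply, dagger_phase_map,
      phase_map, smul_smul] at this
    rw [← key]
    exact smul_left_injective ℂ (regionOne_ne_zero n i j) (by simpa using this)
  · intro h
    constructor <;> refine TwoCell.hom_ext fun i j => LinearMap.ext fun x => ?_
    · simp only [comp_map, id_map, LinearMap.comp_apply, LinearMap.id_apply, dagger_phase_map,
        phase_map, smul_smul, (key i j).2 (h i j), one_smul]
    · simp only [comp_map, id_map, LinearMap.comp_apply, LinearMap.id_apply, dagger_phase_map,
        phase_map, smul_smul, mul_comm (u i j), (key i j).2 (h i j), one_smul]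

/-! ### Measurements in the outcome basis. -/

section Measure

variable {H : unitObj ⟶ unitObj} {n : ℕ}

theorem Measurement.cell_dagger_apply (M : Measurement H n) (x) :
    TwoCell.map M.cell 0 0 (TwoCell.map (dagger M.cell) 0 0 x) = x :=
  LinearMap.congr_fun (congrArg (fun η : witIn n ≫ witOut n ⟶ witIn n ≫ witOut n =>
    TwoCell.map η 0 0) M.unitary.2) x

theorem Measurement.dagger_outcome (M : Measurement H n) (k : Fin n) :
    TwoCell.map (dagger M.cell) 0 0 (outcome n k) = M.basis k := by
  refine M.repr.injective ?_
  have h : M.repr (M.basis k) = EuclideanSpace.single k 1 := M.basis.repr_self k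
  rw [h]
  -- `M.repr` is by definition the measurement followed by the identification of each summand `ℂ ⊗
  -- ℂ` with `ℂ`.
  change LinearIsometryEquiv.piLpCongrRight 2 (fun _ : Fin n => TensorProduct.lidIsometry ℂ ℂ)
    (TwoCell.map M.cell 0 0 (TwoCell.map (dagger M.cell) 0 0 (outcome n k))) = _
  rw [M.cell_dagger_apply]
  change LinearIsometryEquiv.piLpCongrRight 2 (fun _ : Fin n => TensorProduct.lidIsometry ℂ ℂ)
    (PiLp.single 2 k ((1 : ℂ) ⊗ₜ[ℂ] (1 : ℂ))) = _
  rw [LinearIsometryEquiv.piLpCongrRight_single]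
  simp

theorem Measurement.cell_basis (M : Measurement H n) (k : Fin n) :
    TwoCell.map M.cell 0 0 (M.basis k) = outcome n k := by
  rw [← M.dagger_outcome, M.cell_dagger_apply]

/-- Preparation sends outcome `k` to the red vector `k`; its expansion in the green basis then gives
the column `k` of the transition matrix. -/
theorem prepMeasure_outcome (red green : Measurement H n) (k : Fin n) :
    TwoCell.map (prepMeasure red green) 0 0 (outcome n k)
      = ∑ l, (inner ℂ (green.basis l) (red.basis k) : ℂ) • outcome n l := by
  rw [prepMeasure, comp_map, LinearMap.comp_apply, red.dagger_outcome,
    ← green.basis.sum_repr' (red.basis k), map_sum]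
  simp only [map_smul, green.cell_basis, green.basis.sum_repr']

/-! ### Closure of unitary 2-cells under adjoints and composition. -/

theorem dagger_comp {A B : Obj} {F G K : A ⟶ B} (η : F ⟶ G) (θ : G ⟶ K) :
    dagger (η ≫ θ) = dagger θ ≫ dagger η :=
  TwoCell.hom_ext fun _ _ => LinearMap.adjoint_comp _ _

theorem dagger_dagger {A B : Obj} {F G : A ⟶ B} (η : F ⟶ G) : dagger (dagger η) = η :=
  TwoCell.hom_ext fun _ _ => LinearMap.adjoint_adjoint _

theorem IsUnitary.dagger {A B : Obj} {F G : A ⟶ B} {η : F ⟶ G} (h : IsUnitary η) :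
    IsUnitary (dagger η) := by
  rw [IsUnitary, dagger_dagger]
  exact ⟨h.2, h.1⟩

theorem IsUnitary.comp {A B : Obj} {F G K : A ⟶ B} {η : F ⟶ G} {θ : G ⟶ K}
    (hη : IsUnitary η) (hθ : IsUnitary θ) : IsUnitary (η ≫ θ) := by
  rw [IsUnitary, dagger_comp]
  constructor
  · rw [Category.assoc, ← Category.assoc θ, hθ.1, Category.id_comp, hη.1]
  · rw [Category.assoc, ← Category.assoc _ η, hη.2, Category.id_comp, hθ.2]

/-- In the entry `(i, j)`, `copy` forces the input of `f` to be outcome `j`, and `compare` keeps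
only the term of the output with outcome `i`. What survives is the matrix coefficient `u i j`. -/
theorem mateEquiv_eq_phase (f : witIn n ≫ witOut n ⟶ witIn n ≫ witOut n)
    (u : Fin n → Fin n → ℂ)
    (h : ∀ k, TwoCell.map f 0 0 (outcome n k) = ∑ l, u l k • outcome n l) :
    mateEquiv (adjIn n) (adjOut n) f = phase u := by
  refine TwoCell.hom_ext fun i j => regionOne_ext ?_
  rw [Bicategory.mateEquiv_apply, Adjunction.homEquiv₂_apply, Adjunction.homEquiv₁_apply, phase_map]
  simp [adjIn, adjOut, copy, regionOne]
  have hj := h j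
  rw [outcome] at hj
  rw [hj]
  simp only [outcome, map_sum, map_smul, LinearMap.sum_apply, LinearMap.smul_apply, assocHom_gen,
    assocInv_gen, whiskerRight_gen]
  -- `compare` vanishes off the diagonal, which removes every term with `l ≠ i`.
  rw [Finset.sum_eq_single i]
  · rw [compare_same]
    simp
  · intro l _ hl
    rw [compare_ne n (Ne.symm hl)]
    simp
  · simp

/-! ### The two measurement protocols on red basis vectors. -/

theorem sequentialMeasurement_basis (red green : Measurement H n) (k : Fin n) :
    TwoCell.map (sequentialMeasurement red green) 0 0 (red.basis k)
      = ∑ l, (inner ℂ (green.basis l) (red.basis k) : ℂ) •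
        gen (witIn n ≫ witOut n) (witIn n ≫ witOut n) 0 0 0 (outcome n k) (outcome n l) := by
  simp [sequentialMeasurement, red.cell_basis]
  simp [outcome, copy]
  -- The copy of outcome `k` is what is re-encoded, so only the second tensor factor is spread over
  -- the green outcomes.
  have h := prepMeasure_outcome red green k
  simp only [outcome] at h
  rw [h]
  simp only [map_sum, map_smul]

theorem phasedMeasurement_basis (red : Measurement H n) (u : Fin n → Fin n → ℂ) (k : Fin n) :
    TwoCell.map (phasedMeasurement red (phase u)) 0 0 (red.basis k)
      = ∑ l, u k l •
        gen (witIn n ≫ witOut n) (witIn n ≫ witOut n) 0 0 0 (outcome n k) (outcome n l) := by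
  simp [phasedMeasurement, red.cell_basis]
  simp [outcome, create, phase_map]

theorem inner_outcome (k l : Fin n) :
    inner ℂ (outcome n k) (outcome n l) = if l = k then (1 : ℂ) else 0 := by
  rw [outcome, outcome, inner_gen]
  by_cases h : l = k
  · subst h
    rw [dif_pos rfl, if_pos rfl, inner_outVal, inner_inVal]
    simp
  · rw [dif_neg h, if_neg h]

/-- For fixed `k` the vectors `outcome k ⊗ outcome l` are orthonormal, so pairing with the one
indexed by `m` reads off the `m`-th coefficient. -/
theorem coeff_injective {k : Fin n} {u v : Fin n → ℂ}
    (h : ∑ l, u l • gen (witIn n ≫ witOut n) (witIn n ≫ witOut n) 0 0 0 (outcome n k) (outcome n l)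
      = ∑ l, v l •
        gen (witIn n ≫ witOut n) (witIn n ≫ witOut n) 0 0 0 (outcome n k) (outcome n l)) :
    u = v := by
  funext m
  have := congrArg (fun w => (inner ℂ (gen (witIn n ≫ witOut n) (witIn n ≫ witOut n) 0 0 0
    (outcome n k) (outcome n m)) w : ℂ)) h
  simpa only [inner_sum, inner_smul_right, inner_gen, dif_pos, inner_outcome, if_true, one_mul,
    mul_ite, mul_one, mul_zero, Finset.sum_ite_eq', Finset.sum_ite_eq, Finset.mem_univ] using this

/-! ### Reduction of the three conditions to the moduli of the transition matrix. -/

theorem isHorizontallyUnitary_scale_prepMeasure (red green : Measurement H n) (c : ℂ) :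
    IsHorizontallyUnitary (adjIn n) (adjOut n) (scale c (prepMeasure red green)) ↔
      ∀ l k, ‖c‖ ^ 2 * ‖(inner ℂ (green.basis l) (red.basis k) : ℂ)‖ ^ 2 = 1 := by
  rw [IsHorizontallyUnitary, mateEquiv_eq_phase _
    (fun l k => c * inner ℂ (green.basis l) (red.basis k)), isUnitary_phase]
  · simp only [norm_mul, mul_pow]
  · intro k
    change c • TwoCell.map (prepMeasure red green) 0 0 (outcome n k) = _
    rw [prepMeasure_outcome, Finset.smul_sum]
    simp only [smul_smul]

theorem exists_isHorizontallyUnitary_iff (red green : Measurement H n) :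
    (∃ c : ℂ, c ≠ 0 ∧
      IsHorizontallyUnitary (adjIn n) (adjOut n) (scale c (prepMeasure red green))) ↔
      ∀ l k, ‖(inner ℂ (green.basis l) (red.basis k) : ℂ)‖ ^ 2 = 1 / (n : ℝ) := by
  simp only [isHorizontallyUnitary_scale_prepMeasure]
  constructor
  · rintro ⟨c, hc, h⟩ l k
    have hc' : ‖c‖ ^ 2 ≠ 0 := pow_ne_zero 2 (norm_ne_zero_iff.2 hc)
    -- Parseval for the unit vector `red.basis k`. Its `n` coefficients all have squared modulus
    -- `(‖c‖ ^ 2)⁻¹`, so `‖c‖ ^ 2 = n`.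
    have hsum : ∑ l, ‖(inner ℂ (green.basis l) (red.basis k) : ℂ)‖ ^ 2 = 1 := by
      rw [green.basis.sum_sq_norm_inner_right, red.basis.orthonormal.1 k, one_pow]
    have e : ∀ l, ‖(inner ℂ (green.basis l) (red.basis k) : ℂ)‖ ^ 2 = (‖c‖ ^ 2)⁻¹ := fun l =>
      eq_inv_of_mul_eq_one_right (h l k)
    simp only [e, Finset.sum_const, Finset.card_univ, Fintype.card_fin, nsmul_eq_mul] at hsum
    rw [e, one_div]
    exact eq_inv_of_mul_eq_one_right hsum
  · intro h
    -- The natural choice `c = √n` is zero when `n = 0`; there the condition is vacuous and any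
    -- nonzero `c` works.
    rcases Nat.eq_zero_or_pos n with rfl | hn
    · exact ⟨1, one_ne_zero, fun l => l.elim0⟩
    · have hn' : (0 : ℝ) < n := Nat.cast_pos.2 hn
      refine ⟨(√(n : ℝ) : ℝ), Complex.ofReal_ne_zero.2 (Real.sqrt_ne_zero'.2 hn'), fun l k => ?_⟩
      rw [h, Complex.norm_real, Real.norm_eq_abs, sq_abs, Real.sq_sqrt hn'.le,
        mul_one_div_cancel hn'.ne']

theorem physicallyComplementary_iff (red green : Measurement H n) :
    PhysicallyComplementary red green ↔
      ∀ l k, ‖(inner ℂ (green.basis l) (red.basis k) : ℂ)‖ ^ 2 = 1 / (n : ℝ) := by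
  constructor
  · rintro ⟨φ, hφ, h⟩ l k
    obtain ⟨u, rfl⟩ := exists_eq_phase φ
    rw [isUnitary_phase] at hφ
    have hk := congrArg (fun η : H ⟶ (witIn n ≫ witOut n) ≫ witIn n ≫ witOut n =>
      TwoCell.map η 0 0 (red.basis k)) h
    change _ = ((1 / √(n : ℝ) : ℝ) : ℂ) •
      TwoCell.map (phasedMeasurement red (phase u)) 0 0 (red.basis k) at hk
    rw [sequentialMeasurement_basis, phasedMeasurement_basis, Finset.smul_sum] at hk
    simp only [smul_smul] at hk
    -- Comparing coefficients gives `⟪green l, red k⟫ = u k l / √n` with `u k l` unimodular.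
    rw [congrFun (coeff_injective hk) l, norm_mul, mul_pow, hφ, Complex.norm_real,
      Real.norm_eq_abs, sq_abs, mul_one, div_pow, one_pow, Real.sq_sqrt n.cast_nonneg]
  · intro h
    -- The phases are the normalized transition amplitudes. The left region carries the red outcome
    -- `k`, so the array is transposed compared with the one obtained by bending wires.
    refine ⟨phase fun k l => (√(n : ℝ) : ℝ) * inner ℂ (green.basis l) (red.basis k), ?_, ?_⟩
    · rw [isUnitary_phase]
      intro k l
      -- The existence of an index `k` excludes `n = 0`.
      have hn : (n : ℝ) ≠ 0 := Nat.cast_ne_zero.2 (Fin.pos k).ne'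
      rw [norm_mul, mul_pow, h, Complex.norm_real, Real.norm_eq_abs, sq_abs,
        Real.sq_sqrt n.cast_nonneg, mul_one_div_cancel hn]
    · refine TwoCell.hom_ext fun i j => ?_
      obtain rfl : i = 0 := Subsingleton.elim _ _
      obtain rfl : j = 0 := Subsingleton.elim _ _
      refine red.basis.toBasis.ext fun k => ?_
      rw [OrthonormalBasis.coe_toBasis]
      change _ = ((1 / √(n : ℝ) : ℝ) : ℂ) • TwoCell.map (phasedMeasurement red _) 0 0 (red.basis k)
      rw [sequentialMeasurement_basis, phasedMeasurement_basis, Finset.smul_sum]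
      refine Finset.sum_congr rfl fun l _ => ?_
      have hn : (0 : ℝ) < n := Nat.cast_pos.2 (Fin.pos k)
      rw [smul_smul, ← mul_assoc, ← Complex.ofReal_mul,
        one_div_mul_cancel (Real.sqrt_ne_zero'.2 hn), Complex.ofReal_one, one_mul]

theorem areComplementary_iff (red green : Measurement H n) :
    AreComplementary red.basis green.basis ↔
      ∀ l k, ‖(inner ℂ (green.basis l) (red.basis k) : ℂ)‖ ^ 2 = 1 / (n : ℝ) := by
  have hd : Module.finrank ℂ (H.entry 0 0) = n := by
    rw [Module.finrank_eq_card_basis red.basis.toBasis, Fintype.card_fin]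
  -- Complementarity is stated with the red vector first; the modulus of an inner product does not
  -- depend on the order.
  rw [AreComplementary, forall_comm, hd]
  simp only [norm_inner_symm (red.basis _)]

end Measure

end TwoHilbert

theorem mainTheorem7 (n : ℕ) (H : TwoHilbert.unitObj ⟶ TwoHilbert.unitObj)
    (red green : TwoHilbert.Measurement H n) :
    TwoHilbert.IsUnitary (TwoHilbert.prepMeasure red green) ∧
    (TwoHilbert.AreComplementary red.basis green.basis ↔
      ∃ c : ℂ, c ≠ 0 ∧
        TwoHilbert.IsHorizontallyUnitary (TwoHilbert.adjIn n) (TwoHilbert.adjOut n)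
          (TwoHilbert.scale c (TwoHilbert.prepMeasure red green))) ∧
    (TwoHilbert.PhysicallyComplementary red green ↔
      ∃ c : ℂ, c ≠ 0 ∧
        TwoHilbert.IsHorizontallyUnitary (TwoHilbert.adjIn n) (TwoHilbert.adjOut n)
          (TwoHilbert.scale c (TwoHilbert.prepMeasure red green))) := by
  rw [TwoHilbert.exists_isHorizontallyUnitary_iff]
  exact ⟨red.unitary.dagger.comp green.unitary, TwoHilbert.areComplementary_iff red green,
    TwoHilbert.physicallyComplementary_iff red green⟩
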